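/- Let $d\in\mathbb N$, let $\mathbb M$ be a Polish mark space with a finite non-zero Borel measure $\lambda_{\mathbb M}$, let $E=\mathbb R^d\times\mathbb M$ carry the reference measure $\nu=\mathrm{Leb}\otimes\lambda_{\mathbb M}$, and let $\mathbf N$ be the set of all $\gamma\subset E$ with finitely many points in $\Lambda\times\mathbb M$ for every bounded $\Lambda\subset\mathbb R^d$, with the $\sigma$-field generated by the counts $\gamma\mapsto|\gamma\cap B|$, $B\subset E$ measurable. Let $\rho$ be a distance of marked points with $\rho((x,m),(y,n))\ge |x-y|$ for all $(x,m),(y,n)\in E$, where $|\cdot|$ is the Euclidean norm, and put $\rho(\mathbf x,\gamma)=\inf_{\mathbf y\in\gamma}\rho(\mathbf x,\mathbf y)$ (so $\rho(\mathbf x,\emptyset)=\infty$). Let $\Gamma$ be a Gibbs point process with Papangelou intensity $\lambda^*$, i.e. a probability measure on $\mathbf N$ such that, for a measurable $\lambda^*:E\times\mathbf N\to\mathbb R$ which is nonnegative $\nu\otimes\Gamma$-almost everywhere, for all measurable $f:E\times\mathbf N\to[0,\infty]$, $$\int_{\mathbf N}\sum_{\mathbf x\in\gamma}f(\mathbf x,\gamma\setminus\{\mathbf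 x\})\,\Gamma(\mathrm d\gamma)=\int_{\mathbf N}\int_E f(\mathbf x,\gamma)\lambda^*(\mathbf x,\gamma)\,\nu(\mathrm d\mathbf x)\,\Gamma(\mathrm d\gamma).$$ Assume there are constants $C_1,C_2,\delta>0$ such that $\lambda^*(\mathbf x,\gamma)\le C_1$ for all $\mathbf x\in E$, $\gamma\in\mathbf N$, and $\lambda^*(\mathbf x,\gamma)\ge C_2$ whenever $\rho(\mathbf x,\gamma)\ge\delta$. For $s>0$ and $k\in\mathbb Z^d$ let $\mathcal D_k=\prod_{i=1}^d[sk_i,s(k_i+1))$ and let $I^s(\gamma)\in\{0,1\}^{\mathbb Z^d}$ be the occupancy field with $I^s(\gamma)_k=1$ if and only if $\gamma\cap(\mathcal D_k\times\mathbb M)\neq\emptyset$. Then for every $\varepsilon>0$ there is $p\in(0,1]$ such that the law of $I^{2\delta+\varepsilon}(\Gamma)$ stochastically dominates the law of a field $B=(B_i)_{i\in\mathbb Z^d}$ of independent Bernoulli($p$) variables: $\mathbb E\,h(B)\le\mathbb E\,h(I^{2\delta+\varepsilon}(\Gamma))$ for every measurable $h:\{0,1\}^{\mathbb Z^d}\to\mathbb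 R$ that is increasing for the coordinatewise order; in particular $\mathbb P(B_i=1,\ i\in J)\le\mathbb P(I^{2\delta+\varepsilon}(\Gamma)_i=1,\ i\in J)$ for every $J\subset\mathbb Z^d$. -/

import Mathlib

open MeasureTheory ProbabilityTheory
open scoped ENNReal

/-- The space `ℝᵈ × 𝕄` of marked points. -/
abbrev MarkedSpace (d : ℕ) (M : Type*) := EuclideanSpace ℝ (Fin d) × M

/-- Locally finite marked configurations: sets of marked points with finitely many points over
every bounded set of positions. -/
@[ext]
structure Config (d : ℕ) (M : Type*) where
  /-- the set of marked points -/
  carrier : Set (MarkedSpace d M)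
  /-- local finiteness -/
  locallyFinite : ∀ Λ : Set (EuclideanSpace ℝ (Fin d)), Bornology.IsBounded Λ →
    (carrier ∩ Λ ×ˢ Set.univ).Finite

namespace Config

variable {d : ℕ} {M : Type*}

/-- The number of points of `γ` in a set `B` of marked points. -/
noncomputable def count (B : Set (MarkedSpace d M)) (γ : Config d M) : ℕ∞ :=
  (γ.carrier ∩ B).encard

/-- The smallest σ-field making all counts `γ ↦ |γ ∩ B|`, `B` measurable, measurable (the countable
space `ℕ∞` carries its discrete σ-field). -/
noncomputable instance [MeasurableSpace M] : MeasurableSpace (Config d M) :=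
  ⨆ (B : Set (MarkedSpace d M)) (_ : MeasurableSet B), MeasurableSpace.comap (count B) ⊤

/-- The configuration `γ \ {x}`. -/
def erase (γ : Config d M) (x : MarkedSpace d M) : Config d M where
  carrier := γ.carrier \ {x}
  locallyFinite Λ hΛ := (γ.locallyFinite Λ hΛ).subset
    (Set.inter_subset_inter_left _ Set.sdiff_subset)

/-- The number of points of `γ` with position in `Λ`. -/
noncomputable def number (Λ : Set (EuclideanSpace ℝ (Fin d))) (γ : Config d M) : ℕ∞ :=
  count (Λ ×ˢ Set.univ) γ

/-- The distance from a marked point to a configuration, for a given distance `ρ` of marked points;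
it is `∞` for the empty configuration. -/
noncomputable def distTo (ρ : MarkedSpace d M → MarkedSpace d M → ℝ) (x : MarkedSpace d M)
    (γ : Config d M) : ℝ≥0∞ :=
  ⨅ y ∈ γ.carrier, ENNReal.ofReal (ρ x y)

end Config

/-- `Γ` is a Gibbs point process (a probability measure on configurations) with Papangelou
intensity `lam`, with respect to the reference measure `Lebesgue ⊗ μM`: `lam` is jointly
measurable and the Georgii-Nguyen-Zessin equations hold for all nonnegative measurable `f`.
The almost everywhere nonnegativity is what makes their right-hand side an integral
of a nonnegative function. -/
structure IsGibbs {d : ℕ} {M : Type*} [MeasurableSpace M] (μM : Measure M)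
    (lam : MarkedSpace d M → Config d M → ℝ) (Γ : Measure (Config d M)) : Prop where
  isProbabilityMeasure : IsProbabilityMeasure Γ
  measurable : Measurable (Function.uncurry lam)
  nonneg : ∀ᵐ γ ∂Γ, ∀ᵐ x ∂(volume.prod μM), 0 ≤ lam x γ
  gnz : ∀ f : MarkedSpace d M × Config d M → ℝ≥0∞, Measurable f →
    ∫⁻ γ, ∑' x : γ.carrier, f (x, γ.erase x) ∂Γ =
      ∫⁻ γ, ∫⁻ x, f (x, γ) * ENNReal.ofReal (lam x γ) ∂(volume.prod μM) ∂Γ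

/-- The cube of side length `s` with index `k` in the grid of half-open cubes
with vertices in `s ℤᵈ`. -/
def gridCube {d : ℕ} (s : ℝ) (k : Fin d → ℤ) : Set (EuclideanSpace ℝ (Fin d)) :=
  {x | ∀ i, s * k i ≤ x i ∧ x i < s * (k i + 1)}

open Classical in
/-- The occupancy field: its value at `k` is `true` (that is, `1`) iff at least one point of the
configuration has its position in the `k`-th cube of side length `s`. -/
noncomputable def occupancy {d : ℕ} {M : Type*} (s : ℝ) (γ : Config d M) : (Fin d → ℤ) → Bool :=
  fun k => decide (1 ≤ γ.number (gridCube s k))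

/-- The law of a family, indexed by `ℤᵈ`, of independent Bernoulli variables which are
`true` (that is, `1`) with probability `p`. -/
noncomputable def bernoulliField (d : ℕ) (p : unitInterval) : Measure ((Fin d → ℤ) → Bool) :=
  Measure.infinitePi fun _ => bernoulliMeasure true false p

/-- Stochastic domination of `μ` by `ν`: the integrals of all increasing (measurable) functions are
ordered. Such functions are bounded, by their values at the constant fields. -/
def StochDominated {ι : Type*} (μ ν : Measure (ι → Bool)) : Prop :=
  ∀ h : (ι → Bool) → ℝ, Measurable h → Monotone h → ∫ l, h l ∂μ ≤ ∫ l, h l ∂ν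

/-- Domination of `μ` by `ν` on the events that all sites of a given set `J` are occupied. -/
def OrthantDominated {ι : Type*} (μ ν : Measure (ι → Bool)) : Prop :=
  ∀ J : Set ι, μ {l | ∀ i ∈ J, l i = true} ≤ ν {l | ∀ i ∈ J, l i = true}

theorem Config.measurable_count {d : ℕ} {M : Type*} [MeasurableSpace M]
    {B : Set (MarkedSpace d M)} (hB : MeasurableSet B) :
    Measurable[_, ⊤] (Config.count B : Config d M → ℕ∞) := by
  refine Measurable.mono (comap_measurable _) ?_ le_rfl
  exact le_iSup₂_of_le B hB le_rfl

theorem measurableSet_gridCube {d : ℕ} (s : ℝ) (k : Fin d → ℤ) :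
    MeasurableSet (gridCube s k) := by
  unfold gridCube
  simp only [Set.ofPred_forall, Set.ofPred_and]
  refine MeasurableSet.iInter fun i => ?_
  have h : Measurable fun x : EuclideanSpace ℝ (Fin d) => x i := by fun_prop
  exact (measurableSet_le measurable_const h).inter (measurableSet_lt h measurable_const)

/-- The occupancy field is a random variable, so its law is the image measure. -/
theorem measurable_occupancy {d : ℕ} {M : Type*} [MeasurableSpace M] (s : ℝ) :
    Measurable (occupancy s : Config d M → (Fin d → ℤ) → Bool) := by
  classical
  refine measurable_pi_lambda _ fun k => ?_
  have h := Config.measurable_count (M := M)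
    ((measurableSet_gridCube s k).prod MeasurableSet.univ)
  have h2 : Measurable[⊤, _] fun n : ℕ∞ => decide (1 ≤ n) := fun _ _ => trivial
  exact (h2.comp h)

/-! A point inserted into an empty cube of side `2δ + ε`, at distance at least `δ` from its
complement, sees no point within `ρ`-distance `δ`, so the intensity there is at least `C₂`. The
admissible positions form a cube of side `ε`, and the GNZ equations give `c · P(empty, A) ≤
P(occupied, A)` with `c = C₂ εᵈ μM(M)`, for every event `A` on the other cubes
(`IsGibbs.mul_measure_empty_le`). Hence each site is occupied with conditional probability at least
`p = c / (1 + c)` given all others.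

Such a field dominates Bernoulli(`p`): replacing its sites one at a time by fresh Bernoulli
variables only lowers integrals of increasing functions, which settles functions of finitely many
sites. Compactness extends this to all measurable upper sets, and the layer-cake formula to all
increasing functions. -/

open Function in
/-- Resampling one coordinate of a product measure does not change it. -/
theorem infinitePi_map_update {ι : Type*} [DecidableEq ι] {X : ι → Type*}
    [∀ i, MeasurableSpace (X i)] (μ : ∀ i, Measure (X i)) [∀ i, IsProbabilityMeasure (μ i)]
    (k : ι) :
    ((μ k).prod (Measure.infinitePi μ)).map (fun q => update q.2 k q.1) =
      Measure.infinitePi μ := by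
  have hm : Measurable fun q : X k × (∀ i, X i) => update q.2 k q.1 := by
    refine measurable_pi_lambda _ fun i => ?_
    by_cases h : i = k
    · subst h; simpa using measurable_fst
    · simp only [update_of_ne h]; fun_prop
  refine Measure.eq_infinitePi μ fun s t ht => ?_
  rw [Measure.map_apply hm (.pi s.countable_toSet fun i _ => ht i)]
  by_cases hk : k ∈ s
  · have : (fun q : X k × (∀ i, X i) => update q.2 k q.1) ⁻¹' (Set.pi s t) =
        t k ×ˢ Set.pi (s.erase k : Finset ι) t := by
      ext q
      simp only [Set.mem_preimage, Set.mem_pi, Set.mem_prod, Finset.mem_coe, Finset.mem_erase]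
      refine ⟨fun h => ⟨by simpa using h k hk, fun i hi => by simpa [hi.1] using h i hi.2⟩,
        fun h i hi => ?_⟩
      by_cases hik : i = k
      · subst hik; simpa using h.1
      · simpa [hik] using h.2 i ⟨hik, hi⟩
    rw [this, Measure.prod_prod, Measure.infinitePi_pi μ fun i _ => ht i,
      Finset.mul_prod_erase s (fun i => μ i (t i)) hk]
  · have : (fun q : X k × (∀ i, X i) => update q.2 k q.1) ⁻¹' (Set.pi s t) =
        Set.univ ×ˢ Set.pi s t := by
      ext q
      simp only [Set.mem_preimage, Set.mem_pi, Set.mem_prod, Set.mem_univ, true_and]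
      refine forall₂_congr fun i hi => ?_
      have : i ≠ k := fun h => hk (h ▸ hi)
      simp [this]
    rw [this, Measure.prod_prod, Measure.infinitePi_pi μ fun i _ => ht i]
    simp

theorem toNNReal_add_toNNReal_symm (p : unitInterval) :
    (unitInterval.toNNReal p : ℝ≥0∞) + unitInterval.toNNReal (unitInterval.symm p) = 1 := by
  rw [← ENNReal.coe_add, ENNReal.coe_eq_one]
  ext
  simp

/-! ### Comparison on finitely many sites by resampling -/

section Field

open Function

variable {ι : Type*} [DecidableEq ι]

theorem measurable_update_const (k : ι) (b : Bool) :
    Measurable fun l : ι → Bool => update l k b := by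
  refine measurable_pi_lambda _ fun i => ?_
  by_cases h : i = k
  · subst h; simp
  · simp only [update_of_ne h]; fun_prop

theorem lintegral_infinitePi_bernoulli (p : unitInterval) (k : ι)
    {f : (ι → Bool) → ℝ≥0∞} (hf : Measurable f) :
    ∫⁻ l, f l ∂(Measure.infinitePi fun _ : ι => bernoulliMeasure true false p) =
      ∫⁻ l, (unitInterval.toNNReal p * f (update l k true) +
        unitInterval.toNNReal (unitInterval.symm p) * f (update l k false))
        ∂(Measure.infinitePi fun _ : ι => bernoulliMeasure true false p) := by
  have hm : Measurable fun q : Bool × (ι → Bool) => update q.2 k q.1 := by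
    refine measurable_pi_lambda _ fun i => ?_
    by_cases h : i = k
    · subst h; simpa using measurable_fst
    · simp only [update_of_ne h]; fun_prop
  conv_lhs => rw [← infinitePi_map_update (fun _ : ι => bernoulliMeasure true false p) k]
  rw [lintegral_map hf hm, lintegral_prod_symm (fun q : Bool × (ι → Bool) => f (update q.2 k q.1))
    (hf.comp hm).aemeasurable]
  refine lintegral_congr fun l => ?_
  rw [bernoulliMeasure_def, lintegral_add_measure, lintegral_smul_measure, lintegral_smul_measure,
    lintegral_dirac, lintegral_dirac]
  rfl

/-- If, given the values at all other sites, `k` is occupied with probability at least `p`, then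
resampling its value with a Bernoulli(`p`) variable lowers the integrals of increasing
functions. -/
theorem lintegral_resample_le {μ : Measure (ι → Bool)} {p : unitInterval} {k : ι}
    (hμ : ∀ A, MeasurableSet A → unitInterval.toNNReal p * μ ((fun l => update l k false) ⁻¹' A) ≤
      μ ((fun l => update l k false) ⁻¹' A ∩ {l | l k = true}))
    {f : (ι → Bool) → ℝ≥0∞} (hf : Measurable f) (hmono : Monotone f) :
    ∫⁻ l, (unitInterval.toNNReal p * f (update l k true) +
        unitInterval.toNNReal (unitInterval.symm p) * f (update l k false)) ∂μ ≤
      ∫⁻ l, f l ∂μ := by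
  have hr := measurable_update_const k false
  have hk : MeasurableSet {l : ι → Bool | l k = true} :=
    measurableSet_eq_fun (measurable_pi_apply k) measurable_const
  have h0 : Measurable fun l => f (update l k false) := hf.comp hr
  have h1 : Measurable fun l => f (update l k true) := hf.comp (measurable_update_const k true)
  -- The gain from occupying `k` does not depend on the value at `k`, so the hypothesis can be
  -- integrated against it; moreover `f` is its value with `k` emptied plus `g` on `{l k = true}`.
  set g : (ι → Bool) → ℝ≥0∞ := fun l => f (update l k true) - f (update l k false) with hg
  have hgm : Measurable g := h1.sub h0
  have hgr : ∀ l, g (update l k false) = g l := fun l => by simp [hg]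
  have hle : ∀ l : ι → Bool, f (update l k false) ≤ f (update l k true) := fun l =>
    hmono (update_le_update_iff'.2 (by simp))
  have hmeas : (unitInterval.toNNReal p : ℝ≥0∞) • μ.map (fun l => update l k false) ≤
      (μ.restrict {l | l k = true}).map (fun l => update l k false) := by
    refine Measure.le_iff.2 fun A hA => ?_
    rw [Measure.smul_apply, Measure.map_apply hr hA, Measure.map_apply hr hA,
      Measure.restrict_apply (hr hA)]
    exact hμ A hA
  have hint : (unitInterval.toNNReal p : ℝ≥0∞) * ∫⁻ l, g l ∂μ ≤ ∫⁻ l in {l | l k = true}, g l ∂μ := by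
    have := lintegral_mono' hmeas (le_refl g)
    rw [lintegral_smul_measure, lintegral_map hgm hr, lintegral_map hgm hr] at this
    simpa only [hgr, smul_eq_mul] using this
  calc
    _ = ∫⁻ l, (f (update l k false) + unitInterval.toNNReal p * g l) ∂μ := by
        refine lintegral_congr fun l => ?_
        conv_lhs => rw [← add_tsub_cancel_of_le (hle l)]
        rw [mul_add, add_right_comm, ← add_mul, toNNReal_add_toNNReal_symm, one_mul]
    _ = ∫⁻ l, f (update l k false) ∂μ + unitInterval.toNNReal p * ∫⁻ l, g l ∂μ := by
        rw [lintegral_add_left h0, lintegral_const_mul _ hgm]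
    _ ≤ ∫⁻ l, f (update l k false) ∂μ + ∫⁻ l in {l | l k = true}, g l ∂μ := by gcongr
    _ = ∫⁻ l, (f (update l k false) + {l | l k = true}.indicator g l) ∂μ := by
        rw [lintegral_add_left h0, lintegral_indicator hk]
    _ = ∫⁻ l, f l ∂μ := by
        refine lintegral_congr fun l => ?_
        by_cases h : l k = true
        · rw [Set.indicator_of_mem (by exact h), hg, add_tsub_cancel_of_le (hle l), ← h,
            update_eq_self]
        · rw [Set.indicator_of_notMem (by exact h), add_zero, ← Bool.eq_false_of_not_eq_true h,
            update_eq_self]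

/-- Averaging `f` over a Bernoulli value at `k` preserves its product integral, lowers its
`μ`-integral, and leaves an increasing function of one site fewer. Once no site is left, `f` is
constant. -/
theorem lintegral_bernoulli_le_of_dependsOn {μ : Measure (ι → Bool)} [IsProbabilityMeasure μ]
    {p : unitInterval}
    (hμ : ∀ k A, MeasurableSet A →
      unitInterval.toNNReal p * μ ((fun l => update l k false) ⁻¹' A) ≤
        μ ((fun l => update l k false) ⁻¹' A ∩ {l | l k = true}))
    (J : Finset ι) (f : (ι → Bool) → ℝ≥0∞) (hf : Measurable f) (hmono : Monotone f)
    (hJ : DependsOn f (J : Set ι)) :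
    ∫⁻ l, f l ∂(Measure.infinitePi fun _ : ι => bernoulliMeasure true false p) ≤
      ∫⁻ l, f l ∂μ := by
  induction J using Finset.induction_on generalizing f with
  | empty =>
    have : f = fun _ => f ⊥ := funext fun l => hJ (by simp)
    rw [this]
    simp
  | insert k J hk ih =>
    rw [lintegral_infinitePi_bernoulli p k hf]
    refine (ih _ ?_ ?_ ?_).trans (lintegral_resample_le (hμ k) hf hmono)
    · have h0 := hf.comp (measurable_update_const k false)
      have h1 := hf.comp (measurable_update_const k true)
      exact (h1.const_mul _).add (h0.const_mul _)
    · intro l l' hl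
      have : ∀ b, f (update l k b) ≤ f (update l' k b) := fun b =>
        hmono (update_le_update_iff.2 ⟨le_rfl, fun i _ => hl i⟩)
      dsimp only
      gcongr <;> exact this _
    · intro l l' hl
      have : ∀ b, f (update l k b) = f (update l' k b) := fun b => hJ fun i hi => by
        by_cases hik : i = k
        · subst hik; simp
        · simpa [hik] using hl i (by simpa [hik] using hi)
      simp only [this]

end Field

/-! ### From finitely many sites to all increasing functions -/

/-- Upper sets depending on finitely many sites determine the order of measures on all measurable
upper sets. -/
theorem measure_le_of_isUpperSet {ι : Type*} [Countable ι] {μ ν : Measure (ι → Bool)}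
    [IsFiniteMeasure μ] [IsFiniteMeasure ν]
    (h : ∀ (J : Finset ι) (U : Set (ι → Bool)), MeasurableSet U → IsUpperSet U →
      DependsOn (· ∈ U) (J : Set ι) → μ U ≤ ν U)
    {U : Set (ι → Bool)} (hU : MeasurableSet U) (hup : IsUpperSet U) : μ U ≤ ν U := by
  refine ENNReal.le_of_forall_pos_le_add fun ε hε _ => ?_
  obtain ⟨K, hKU, hK, hlt⟩ := hU.exists_isCompact_lt_add (measure_ne_top μ U)
    (ε := (ε : ℝ≥0∞)) (by simpa using hε.ne')
  refine hlt.le.trans (add_le_add_left ?_ _)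
  -- The upper closure of `K` as seen through the sites of `J`: a finite-site upper set containing
  -- `K`, decreasing in `J`.
  set V : Finset ι → Set (ι → Bool) := fun J => {l | ∃ m ∈ K, ∀ i ∈ J, m i ≤ l i} with hV
  have hVdep : ∀ J, DependsOn (· ∈ V J) (J : Set ι) := fun J l l' hl => by
    simp only [hV, Set.mem_ofPred_eq, eq_iff_iff]
    exact exists_congr fun m => and_congr_right fun _ => forall₂_congr fun i hi => by
      rw [hl i (by simpa using hi)]
  have hVmeas : ∀ J, MeasurableSet (V J) := fun J => by
    have : V J = J.restrict ⁻¹' (J.restrict '' V J) := by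
      refine (Set.subset_preimage_image _ _).antisymm ?_
      rintro l ⟨l', hl', hll'⟩
      have := hVdep J (x := l') (y := l) fun i hi => congrFun hll' ⟨i, hi⟩
      exact this.mp hl'
    rw [this]
    exact (Finset.measurable_restrict J) (Set.toFinite _).measurableSet
  have hVup : ∀ J, IsUpperSet (V J) := fun J l l' hl ⟨m, hm, hml⟩ =>
    ⟨m, hm, fun i hi => (hml i hi).trans (hl i)⟩
  have hVanti : Antitone V := fun J J' hJ l ⟨m, hm, hml⟩ => ⟨m, hm, fun i hi => hml i (hJ hi)⟩
  -- For `l` in every `V J`, the compact sets of witnesses in `K` are nonempty and directed, so a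
  -- single `m ∈ K` lies below `l` at all sites.
  have hinter : ⋂ J, V J ⊆ U := by
    intro l hl
    set W : Finset ι → Set (ι → Bool) := fun J => K ∩ {m | ∀ i ∈ J, m i ≤ l i} with hW
    have hclosed : ∀ J : Finset ι, IsClosed {m : ι → Bool | ∀ i ∈ J, m i ≤ l i} := fun J => by
      simp only [Set.ofPred_forall]
      exact isClosed_biInter fun i _ => by
        have : IsClosed ((fun m : ι → Bool => m i) ⁻¹' Set.Iic (l i)) :=
          (isClosed_discrete _).preimage (continuous_apply i)
        exact this
    have hne : (⋂ J, W J).Nonempty := by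
      refine IsCompact.nonempty_iInter_of_directed_nonempty_isCompact_isClosed W ?_ ?_ ?_ ?_
      · exact directed_of_isDirected_le fun J J' hJ m hm => ⟨hm.1, fun i hi => hm.2 i (Finset.mem_of_subset hJ hi)⟩
      · intro J
        obtain ⟨m, hm, hml⟩ := Set.mem_iInter.1 hl J
        exact ⟨m, hm, hml⟩
      · exact fun J => hK.inter_right (hclosed J)
      · exact fun J => hK.isClosed.inter (hclosed J)
    obtain ⟨m, hm⟩ := hne
    rw [Set.mem_iInter] at hm
    exact hup (fun i => (hm {i}).2 i (by simp)) (hKU (hm ∅).1)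
  have hlim := tendsto_measure_iInter_atTop (μ := ν) (fun J => (hVmeas J).nullMeasurableSet) hVanti
    ⟨∅, measure_ne_top _ _⟩
  refine (ge_of_tendsto' hlim fun J => ?_).trans (measure_mono hinter)
  exact (measure_mono (t := V J) fun m hm => ⟨m, hm, fun _ _ => le_rfl⟩).trans
    (h J (V J) (hVmeas J) (hVup J) (hVdep J))

/-- Layer-cake: subtracting the minimum `f ⊥` makes `f` nonnegative, and its superlevel sets are
upper sets. -/
theorem stochDominated_of_isUpperSet {ι : Type*} {μ ν : Measure (ι → Bool)}
    [IsProbabilityMeasure μ] [IsProbabilityMeasure ν]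
    (h : ∀ U, MeasurableSet U → IsUpperSet U → μ U ≤ ν U) : StochDominated μ ν := by
  intro f hf hmono
  have hbdd : ∀ l, f ⊥ ≤ f l ∧ f l ≤ f ⊤ := fun l => ⟨hmono bot_le, hmono le_top⟩
  have hint : ∀ (κ : Measure (ι → Bool)) [IsProbabilityMeasure κ], Integrable f κ := fun κ _ =>
    Integrable.of_mem_Icc (f ⊥) (f ⊤) hf.aemeasurable (.of_forall hbdd)
  have hnn : ∀ κ : Measure (ι → Bool), 0 ≤ᵐ[κ] fun l => f l - f ⊥ := fun κ =>
    .of_forall fun l => sub_nonneg.2 (hbdd l).1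
  have hm : Measurable fun l => f l - f ⊥ := hf.sub_const _
  have hle : ∫⁻ l, ENNReal.ofReal (f l - f ⊥) ∂μ ≤ ∫⁻ l, ENNReal.ofReal (f l - f ⊥) ∂ν := by
    rw [lintegral_eq_lintegral_meas_le μ (hnn μ) hm.aemeasurable,
      lintegral_eq_lintegral_meas_le ν (hnn ν) hm.aemeasurable]
    refine lintegral_mono fun t => h _ (measurableSet_le measurable_const hm) ?_
    intro l l' hl (hlt : t ≤ f l - f ⊥)
    exact hlt.trans (sub_le_sub_right (hmono hl) _)
  have heq : ∀ (κ : Measure (ι → Bool)) [IsProbabilityMeasure κ],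
      ∫ l, f l ∂κ = (∫⁻ l, ENNReal.ofReal (f l - f ⊥) ∂κ).toReal + f ⊥ := fun κ _ => by
    rw [← integral_eq_lintegral_of_nonneg_ae (hnn κ) hm.aestronglyMeasurable,
      integral_sub (hint κ) (integrable_const _)]
    simp
  rw [heq μ, heq ν]
  refine add_le_add_left (ENNReal.toReal_mono ?_ hle) _
  exact ((hint ν).sub (integrable_const (f ⊥))).lintegral_lt_top.ne

theorem orthantDominated_of_isUpperSet {ι : Type*} [Countable ι] {μ ν : Measure (ι → Bool)}
    (h : ∀ U, MeasurableSet U → IsUpperSet U → μ U ≤ ν U) : OrthantDominated μ ν := by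
  intro J
  refine h _ ?_ fun l l' hl hJ i hi => ?_
  · simp only [Set.ofPred_forall]
    exact .biInter J.to_countable fun i _ => measurableSet_eq_fun (measurable_pi_apply i) measurable_const
  · exact top_le_iff.1 ((hJ i hi).symm.le.trans (hl i))

/-- A random field on countably many sites which occupies each of them with conditional probability
at least `p` given the values at the other sites dominates a Bernoulli(`p`) field on upper
sets. -/
theorem bernoulli_le_of_site_bound {ι : Type*} [Countable ι] [DecidableEq ι]
    {μ : Measure (ι → Bool)} [IsProbabilityMeasure μ] {p : unitInterval}
    (hμ : ∀ k A, MeasurableSet A →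
      unitInterval.toNNReal p * μ ((fun l => Function.update l k false) ⁻¹' A) ≤
        μ ((fun l => Function.update l k false) ⁻¹' A ∩ {l | l k = true}))
    (U : Set (ι → Bool)) (hU : MeasurableSet U) (hup : IsUpperSet U) :
    (Measure.infinitePi fun _ : ι => bernoulliMeasure true false p) U ≤ μ U := by
  refine measure_le_of_isUpperSet (fun J V hV hVup hVJ => ?_) hU hup
  have := lintegral_bernoulli_le_of_dependsOn hμ J (V.indicator 1) (measurable_one.indicator hV)
    (fun l l' hl => ?_) (fun l l' hl => ?_)
  · simpa [lintegral_indicator_one hV] using this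
  · by_cases h : l ∈ V
    · simp [h, hVup hl h]
    · simp [h]
  · have : l ∈ V ↔ l' ∈ V := (hVJ hl).to_iff
    by_cases h : l ∈ V
    · simp [h, this.1 h]
    · simp [h, mt this.2 h]

/-! ### Geometry of the cubes -/

/-- The part of a grid cube at distance at least `δ` from its complement. -/
def innerCube {d : ℕ} (s δ : ℝ) (k : Fin d → ℤ) : Set (EuclideanSpace ℝ (Fin d)) :=
  {x | ∀ i, s * k i + δ ≤ x i ∧ x i < s * (k i + 1) - δ}

theorem innerCube_eq_preimage {d : ℕ} (s δ : ℝ) (k : Fin d → ℤ) :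
    innerCube s δ k = (WithLp.ofLp : EuclideanSpace ℝ (Fin d) → Fin d → ℝ) ⁻¹'
      Set.univ.pi fun i => Set.Ico (s * k i + δ) (s * (k i + 1) - δ) := by
  ext x
  simp [innerCube]

theorem measurableSet_innerCube {d : ℕ} (s δ : ℝ) (k : Fin d → ℤ) :
    MeasurableSet (innerCube s δ k) := by
  rw [innerCube_eq_preimage]
  exact (PiLp.volume_preserving_ofLp (Fin d)).measurable
    (.univ_pi fun _ => measurableSet_Ico)

theorem volume_innerCube {d : ℕ} (s δ : ℝ) (k : Fin d → ℤ) :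
    volume (innerCube s δ k) = ENNReal.ofReal (s - 2 * δ) ^ d := by
  rw [innerCube_eq_preimage, (PiLp.volume_preserving_ofLp (Fin d)).measure_preimage
    (MeasurableSet.univ_pi fun _ => measurableSet_Ico).nullMeasurableSet, Real.volume_pi_Ico]
  have : ∀ i, s * (k i + 1) - δ - (s * k i + δ) = s - 2 * δ := fun i => by ring
  simp [this]

theorem innerCube_subset_gridCube {d : ℕ} {s δ : ℝ} (hδ : 0 ≤ δ) (k : Fin d → ℤ) :
    innerCube s δ k ⊆ gridCube s k := fun x hx i => by
  have := hx i
  constructor <;> linarith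

theorem le_dist_of_mem_innerCube {d : ℕ} {s δ : ℝ} {k : Fin d → ℤ}
    {x y : EuclideanSpace ℝ (Fin d)} (hx : x ∈ innerCube s δ k) (hy : y ∉ gridCube s k) :
    δ ≤ dist x y := by
  simp only [gridCube, Set.mem_ofPred_eq, not_forall, not_and_or, not_le, not_lt] at hy
  obtain ⟨i, hi⟩ := hy
  have hle : |x i - y i| ≤ dist x y := by
    rw [dist_eq_norm]
    exact PiLp.norm_apply_le (x - y) i
  refine le_trans ?_ hle
  have := hx i
  rcases hi with hi | hi
  · exact le_trans (by linarith) (le_abs_self _)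
  · exact le_trans (by linarith) (neg_le_abs _)

theorem eq_of_mem_gridCube {d : ℕ} {s : ℝ} (hs : 0 < s) {j k : Fin d → ℤ}
    {x : EuclideanSpace ℝ (Fin d)} (hj : x ∈ gridCube s j) (hk : x ∈ gridCube s k) : j = k := by
  funext i
  have h1 : (j i : ℝ) < k i + 1 := lt_of_mul_lt_mul_left ((hj i).1.trans_lt (hk i).2) hs.le
  have h2 : (k i : ℝ) < j i + 1 := lt_of_mul_lt_mul_left ((hk i).1.trans_lt (hj i).2) hs.le
  norm_cast at h1 h2
  omega

/-! ### Inserting a point into an empty cube -/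

section Occupancy

variable {d : ℕ} {M : Type*}

theorem occupancy_eq_true_iff {s : ℝ} {γ : Config d M} {k : Fin d → ℤ} :
    occupancy s γ k = true ↔ ∃ y ∈ γ.carrier, y.1 ∈ gridCube s k := by
  rw [occupancy, decide_eq_true_iff, Config.number, Config.count, Set.one_le_encard_iff_nonempty]
  exact exists_congr fun y => by simp

/-- The cubes are disjoint, so removing a point of cube `k` affects no other cube. -/
theorem update_occupancy_erase {s : ℝ} (hs : 0 < s) {γ : Config d M} {k : Fin d → ℤ}
    {x : MarkedSpace d M} (hx : x.1 ∈ gridCube s k) :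
    Function.update (occupancy s (γ.erase x)) k false =
      Function.update (occupancy s γ) k false := by
  funext j
  by_cases hj : j = k
  · subst hj; simp
  rw [Function.update_of_ne hj, Function.update_of_ne hj, Bool.eq_iff_iff, occupancy_eq_true_iff,
    occupancy_eq_true_iff]
  refine ⟨fun ⟨y, hy, hyj⟩ => ⟨y, hy.1, hyj⟩, fun ⟨y, hy, hyj⟩ => ⟨y, ⟨hy, ?_⟩, hyj⟩⟩
  rintro rfl
  exact hj (eq_of_mem_gridCube hs hyj hx)

theorem le_distTo_of_mem_innerCube {s δ : ℝ} {k : Fin d → ℤ} {γ : Config d M}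
    {ρ : MarkedSpace d M → MarkedSpace d M → ℝ} (hρ : ∀ x y, dist x.1 y.1 ≤ ρ x y)
    {x : MarkedSpace d M} (hx : x.1 ∈ innerCube s δ k) (hγ : occupancy s γ k = false) :
    ENNReal.ofReal δ ≤ γ.distTo ρ x := by
  refine le_iInf₂ fun y hy => ENNReal.ofReal_le_ofReal ?_
  refine (le_dist_of_mem_innerCube hx fun hyk => ?_).trans (hρ x y)
  exact Bool.eq_false_iff.1 hγ (occupancy_eq_true_iff.2 ⟨y, hy, hyk⟩)

variable [MeasurableSpace M]

/-- The Georgii-Nguyen-Zessin equations, for the insertion of one point into an empty cube, bound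
the probability of an empty cube by that of an occupied one, on every event that concerns the
other cubes. -/
theorem IsGibbs.mul_measure_empty_le {μM : Measure M} [IsFiniteMeasure μM]
    {ρ : MarkedSpace d M → MarkedSpace d M → ℝ} (hρ : ∀ x y, dist x.1 y.1 ≤ ρ x y)
    {lam : MarkedSpace d M → Config d M → ℝ} {C δ s : ℝ} (hs : 0 < s) (hδ : 0 ≤ δ)
    (hlower : ∀ x γ, ENNReal.ofReal δ ≤ γ.distTo ρ x → C ≤ lam x γ)
    {Γ : Measure (Config d M)} (hΓ : IsGibbs μM lam Γ) (k : Fin d → ℤ)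
    {A : Set ((Fin d → ℤ) → Bool)} (hA : MeasurableSet A) :
    ENNReal.ofReal C * (ENNReal.ofReal (s - 2 * δ) ^ d * μM Set.univ) *
        Γ {γ | Function.update (occupancy s γ) k false ∈ A ∧ occupancy s γ k = false} ≤
      Γ {γ | Function.update (occupancy s γ) k false ∈ A ∧ occupancy s γ k = true} := by
  set Q : Set (MarkedSpace d M) := innerCube s δ k ×ˢ Set.univ
  have hQm : MeasurableSet Q := (measurableSet_innerCube s δ k).prod .univ
  have hocc : Measurable (occupancy s : Config d M → (Fin d → ℤ) → Bool) := measurable_occupancy s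
  have hG : ∀ b, MeasurableSet {γ : Config d M |
      Function.update (occupancy s γ) k false ∈ A ∧ occupancy s γ k = b} := fun b =>
    (((measurable_update_const k false).comp hocc) hA).inter
      (measurableSet_eq_fun ((measurable_pi_apply k).comp hocc) measurable_const)
  set G := {γ : Config d M | Function.update (occupancy s γ) k false ∈ A ∧ occupancy s γ k = false}
  set G' := {γ : Config d M | Function.update (occupancy s γ) k false ∈ A ∧ occupancy s γ k = true}
  have hgnz := hΓ.gnz ((Q ×ˢ G).indicator 1) (measurable_one.indicator (hQm.prod (hG false)))
  have hleft : ∫⁻ γ, ∑' x : γ.carrier, (Q ×ˢ G).indicator 1 ((x : MarkedSpace d M), γ.erase x) ∂Γ ≤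
      Γ G' := by
    rw [← lintegral_indicator_one (show MeasurableSet G' from hG true)]
    refine lintegral_mono fun γ => ?_
    by_cases hγ : ∃ x : γ.carrier, ((x : MarkedSpace d M), γ.erase x) ∈ Q ×ˢ G
    · obtain ⟨x, hx⟩ := hγ
      have hxk : x.1.1 ∈ gridCube s k := innerCube_subset_gridCube hδ k hx.1.1
      -- If removing `x` empties cube `k`, then `x` was its only point: the sum has at most one
      -- nonzero term.
      rw [tsum_eq_single x fun y hy => Set.indicator_of_notMem ?_ _]
      · have : γ ∈ G' := ⟨by
          rw [← update_occupancy_erase hs hxk]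
          exact hx.2.1, occupancy_eq_true_iff.2 ⟨x, x.2, hxk⟩⟩
        simp [hx, this]
      · intro hyQ
        refine Bool.eq_false_iff.1 hyQ.2.2 (occupancy_eq_true_iff.2 ⟨x, ⟨x.2, ?_⟩, hxk⟩)
        exact fun h => hy (Subtype.ext h.symm)
    · rw [not_exists] at hγ
      simp [hγ]
  have hright : ENNReal.ofReal C * (ENNReal.ofReal (s - 2 * δ) ^ d * μM Set.univ) * Γ G ≤
      ∫⁻ γ, ∫⁻ x, (Q ×ˢ G).indicator 1 (x, γ) * ENNReal.ofReal (lam x γ) ∂(volume.prod μM) ∂Γ := by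
    rw [← lintegral_indicator_const (show MeasurableSet G from hG false)]
    refine lintegral_mono fun γ => ?_
    by_cases hγ : γ ∈ G
    · rw [Set.indicator_of_mem hγ, ← volume_innerCube s δ k, ← Measure.prod_prod,
        ← lintegral_indicator_const hQm]
      refine lintegral_mono fun x => ?_
      by_cases hx : x ∈ Q
      · have hxγ : (x, γ) ∈ Q ×ˢ G := ⟨hx, hγ⟩
        rw [Set.indicator_of_mem hx, Set.indicator_of_mem hxγ, Pi.one_apply, one_mul]
        exact ENNReal.ofReal_le_ofReal
          (hlower x γ (le_distTo_of_mem_innerCube hρ hx.1 hγ.2))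
      · simp [Set.indicator_of_notMem hx]
    · simp [Set.indicator_of_notMem hγ]
  exact hright.trans (hgnz.symm.trans_le hleft)

end Occupancy

/-! ### The domination theorem -/

theorem propositionL4 {d : ℕ} {M : Type*} [TopologicalSpace M] [PolishSpace M]
    [MeasurableSpace M] [BorelSpace M] (μM : Measure M) [IsFiniteMeasure μM] (hμM : μM ≠ 0)
    (ρ : MarkedSpace d M → MarkedSpace d M → ℝ) (hρ : ∀ x y, dist x.1 y.1 ≤ ρ x y)
    (lam : MarkedSpace d M → Config d M → ℝ) (C₁ C₂ δ : ℝ)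
    (hC₁ : 0 < C₁) (hC₂ : 0 < C₂) (hδ : 0 < δ)
    (hupper : ∀ x γ, lam x γ ≤ C₁)
    (hlower : ∀ x γ, ENNReal.ofReal δ ≤ γ.distTo ρ x → C₂ ≤ lam x γ)
    (Γ : Measure (Config d M)) (hΓ : IsGibbs μM lam Γ) (ε : ℝ) (hε : 0 < ε) :
    ∃ p : unitInterval, 0 < p ∧
      StochDominated (bernoulliField d p) (Γ.map (occupancy (2 * δ + ε))) ∧
      OrthantDominated (bernoulliField d p) (Γ.map (occupancy (2 * δ + ε))) := by
  have := hΓ.isProbabilityMeasure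
  set s := 2 * δ + ε with hs
  have hs0 : 0 < s := by positivity
  have hocc : Measurable (occupancy s : Config d M → (Fin d → ℤ) → Bool) := measurable_occupancy s
  have := Measure.isProbabilityMeasure_map (μ := Γ) hocc.aemeasurable
  have hM : 0 < μM.real Set.univ :=
    ENNReal.toReal_pos (Measure.measure_univ_ne_zero.2 hμM) (measure_ne_top _ _)
  set c : ℝ := C₂ * (ε ^ d * μM.real Set.univ) with hc
  have hc0 : 0 < c := by positivity
  -- With `a`, `b` the probabilities of empty and occupied, `c * a ≤ b` is equivalent to `p * (b +
  -- a) ≤ b` for this `p`.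
  set p : unitInterval := ⟨c / (1 + c), by positivity, by rw [div_le_one] <;> linarith⟩
  have hsite : ∀ k A, MeasurableSet A →
      unitInterval.toNNReal p *
        Γ.map (occupancy s) ((fun l => Function.update l k false) ⁻¹' A) ≤
      Γ.map (occupancy s) ((fun l => Function.update l k false) ⁻¹' A ∩ {l | l k = true}) := by
    intro k A hA
    have hA' := measurable_update_const k false hA
    have hk : MeasurableSet {l : (Fin d → ℤ) → Bool | l k = true} :=
      measurableSet_eq_fun (measurable_pi_apply k) measurable_const
    have key := hΓ.mul_measure_empty_le hρ hs0 hδ.le hlower k hA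
    rw [Measure.map_apply hocc hA', Measure.map_apply hocc (hA'.inter hk)]
    have hsplit := measure_inter_add_sdiff (μ := Γ)
      (occupancy s ⁻¹' ((fun l => Function.update l k false) ⁻¹' A)) (hocc hk)
    have hempty : occupancy s ⁻¹' ((fun l => Function.update l k false) ⁻¹' A) \
        occupancy s ⁻¹' {l | l k = true} = {γ : Config d M |
          Function.update (occupancy s γ) k false ∈ A ∧ occupancy s γ k = false} := by
      ext γ
      simp
    rw [hempty] at hsplit
    have hcE : ENNReal.ofReal C₂ * (ENNReal.ofReal (s - 2 * δ) ^ d * μM Set.univ) =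
        ENNReal.ofReal c := by
      rw [hc, ENNReal.ofReal_mul hC₂.le, ENNReal.ofReal_mul (by positivity),
        ENNReal.ofReal_pow hε.le, ofReal_measureReal, hs, add_sub_cancel_left]
    have hpE : (unitInterval.toNNReal p : ℝ≥0∞) = ENNReal.ofReal (c / (1 + c)) := by
      rw [ENNReal.ofReal, ENNReal.coe_inj]
      ext
      rw [Real.coe_toNNReal _ (by positivity)]
      rfl
    rw [hcE] at key
    rw [← hsplit, hpE, Set.preimage_inter]
    set a := Γ {γ | Function.update (occupancy s γ) k false ∈ A ∧ occupancy s γ k = false}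
    set b := Γ (occupancy s ⁻¹' ((fun l => Function.update l k false) ⁻¹' A) ∩
      occupancy s ⁻¹' {l | l k = true})
    have key' : ENNReal.ofReal c * a ≤ b := key
    calc ENNReal.ofReal (c / (1 + c)) * (b + a)
        = ENNReal.ofReal (c / (1 + c)) * b + ENNReal.ofReal (1 / (1 + c)) *
            (ENNReal.ofReal c * a) := by
          rw [mul_add, ← mul_assoc (ENNReal.ofReal (1 / (1 + c))),
            ← ENNReal.ofReal_mul (by positivity), one_div_mul_eq_div]
      _ ≤ ENNReal.ofReal (c / (1 + c)) * b + ENNReal.ofReal (1 / (1 + c)) * b := by gcongr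
      _ = b := by
          rw [← add_mul, ← ENNReal.ofReal_add (by positivity) (by positivity), ← add_div,
            add_comm c, div_self (by positivity), ENNReal.ofReal_one, one_mul]
  have hdom := bernoulli_le_of_site_bound hsite
  refine ⟨p, ?_, ?_, ?_⟩
  · exact Subtype.mk_lt_mk.2 (by positivity)
  · have : IsProbabilityMeasure (bernoulliField d p) := by
      unfold bernoulliField; infer_instance
    exact stochDominated_of_isUpperSet hdom
  · exact orthantDominated_of_isUpperSet hdom
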